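/- Let $\mathbb L/\mathbb K$ be a finite cyclic Galois extension of degree $n$ with Galois group generated by $\theta$, and let $\mathrm N=\mathrm N_{\mathbb L/\mathbb K}$ be its norm. Let $\mathbb L[X;\theta]$ be the skew polynomial ring, with $Xa=\theta(a)X$ for $a\in\mathbb L$. For $F=\sum_{i=0}^d f_iX^i\in\mathbb L[X;\theta]$ let $\ker(F)$ be the kernel of the $\mathbb K$-linear map $\mathbb L\to\mathbb L$, $\beta\mapsto\sum_i f_i\theta^i(\beta)$; for $\alpha\in\mathbb L^*$ put $F_\alpha=\sum_i f_i\big(\prod_{j=0}^{i-1}\theta^j(\alpha)\big)X^i$; for $\lambda\in\mathbb K$ put $d_\lambda(F)=\deg\gcd_r(F,X^n-\lambda)$, where $\gcd_r$ is the greatest common right divisor. If $F$ is nonzero of degree $d$, let $C_F\in\mathbb L^{d\times d}$ be its companion matrix (ones on the subdiagonal, last column $(-f_i/f_d)_{0\le i<d}$, all other entries zero) and $A_F=C_F\,\theta(C_F)\cdots\theta^{n-1}(C_F)$, with $\theta$ applied entrywise. **Theorem.** Let $F\in\mathbb L[X;\theta]$ be nonzero, let $\mathrm A\subseteq\mathbb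 L^*$ be a (possibly infinite) set whose elements have pairwise distinct norms, and let $\Lambda=\mathrm N(\mathrm A)$. Then the set $\{\alpha\in \mathrm A\mid\ker(F_\alpha)\ne\{0\}\}$ is finite and $$\sum_{\alpha\in \mathrm A}\dim_{\mathbb K}\ker(F_\alpha)\le\deg F .$$ Moreover, the following are equivalent: 1. $\sum_{\alpha\in \mathrm A}\dim_{\mathbb K}\ker(F_\alpha)=\deg F$. 2. $A_F$ is diagonalizable over $\mathbb L$, its set of eigenvalues is $\{\lambda\in\Lambda\mid d_\lambda(F)>0\}$, and each such $\lambda$ has (algebraic) multiplicity $d_\lambda(F)$. 3. $F$ right-divides $\prod_{\lambda\in\Lambda}(X^n-\lambda)$ if $\Lambda$ is finite; for arbitrary $\Lambda$: $F$ right-divides $\prod_{\lambda\in\Lambda'}(X^n-\lambda)$ for some finite subset $\Lambda'\subseteq\Lambda$. -/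

import Mathlib

noncomputable section

namespace SumRank

variable {K L : Type*} [Field K] [Field L] [Algebra K L]

/-- The action of `(ℕ, +)` on `L` through the powers of `θ`: the generator acts as `θ`. -/
abbrev thetaAction (θ : L ≃ₐ[K] L) : MulSemiringAction (Multiplicative ℕ) L :=
  MulSemiringAction.compHom L (powersHom (L ≃ₐ[K] L) θ)

/-- The skew polynomial ring `L[X; θ]`: Mathlib's type of skew polynomials over `L`, with the
multiplication determined by `X a = θ(a) X`. -/
def SkewPoly (_θ : L ≃ₐ[K] L) : Type _ := SkewPolynomial L

namespace SkewPoly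

variable {θ : L ≃ₐ[K] L}

instance : Ring (SkewPoly θ) :=
  letI := thetaAction θ
  inferInstanceAs (Ring (SkewPolynomial L))

/-- The coefficient of `X ^ i`. -/
def coeff (F : SkewPoly θ) (i : ℕ) : L := SkewPolynomial.coeff (R := L) F i

/-- The support `{i | coeff F i ≠ 0}`. -/
def support (F : SkewPoly θ) : Finset ℕ := SkewPolynomial.support (R := L) F

/-- The degree `max {i | coeff F i ≠ 0}` (and `0` for the zero polynomial). -/
def natDegree (F : SkewPoly θ) : ℕ := F.support.sup id

/-- The monomial `a X ^ i`. -/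
def monomial (θ : L ≃ₐ[K] L) (i : ℕ) (a : L) : SkewPoly θ := SkewPolynomial.monomial (R := L) i a

/-- The constant skew polynomial `a`. -/
def C (θ : L ≃ₐ[K] L) (a : L) : SkewPoly θ := monomial θ 0 a

/-- The indeterminate. -/
def X (θ : L ≃ₐ[K] L) : SkewPoly θ := monomial θ 1 1

theorem ext {F G : SkewPoly θ} (h : ∀ i, F.coeff i = G.coeff i) : F = G :=
  SkewPolynomial.ext (R := L) h

@[simp] theorem coeff_zero (i : ℕ) : (0 : SkewPoly θ).coeff i = 0 := rfl

theorem coeff_add (F G : SkewPoly θ) (i : ℕ) : (F + G).coeff i = F.coeff i + G.coeff i :=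
  SkewPolynomial.coeff_add (R := L) F G i

theorem coeff_sub (F G : SkewPoly θ) (i : ℕ) : (F - G).coeff i = F.coeff i - G.coeff i :=
  let _ := thetaAction θ
  SkewPolynomial.coeff_sub (R := L) F G i

theorem coeff_monomial (i j : ℕ) (a : L) :
    (monomial θ i a).coeff j = if i = j then a else 0 :=
  SkewPolynomial.coeff_monomial (R := L)

theorem mem_support {F : SkewPoly θ} {i : ℕ} : i ∈ F.support ↔ F.coeff i ≠ 0 :=
  SkewPolynomial.mem_support_iff (R := L)

theorem monomial_mul_monomial (i j : ℕ) (a b : L) :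
    monomial θ i a * monomial θ j b = monomial θ (i + j) (a * (θ ^ i) b) := by
  letI := thetaAction θ
  refine (SkewPolynomial.monomial_mul_monomial (R := L) i j a b).trans ?_
  rw [SkewPolynomial.φ_iterate_apply]
  rfl

/-- The defining relation of the skew polynomial ring. -/
theorem X_mul_C (a : L) : X θ * C θ a = C θ (θ a) * X θ := by
  simp [X, C, monomial_mul_monomial]

theorem X_pow (i : ℕ) : X θ ^ i = monomial θ i 1 := by
  induction i with
  | zero => rfl
  | succ i ih => rw [pow_succ, ih, X, monomial_mul_monomial]; simp

theorem induction_on {p : SkewPoly θ → Prop} (F : SkewPoly θ) (h0 : p 0)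
    (h : ∀ (i : ℕ) (a : L) (G : SkewPoly θ), p G → p (monomial θ i a + G)) : p F :=
  SkewPolynomial.induction (R := L) (motive := p) F h0 fun i a G _ _ hG => h i a G hG

theorem coeff_monomial_mul (k : ℕ) (c : L) (D : SkewPoly θ) (i : ℕ) :
    (monomial θ k c * D).coeff i = if k ≤ i then c * (θ ^ k) (D.coeff (i - k)) else 0 := by
  induction D using induction_on with
  | h0 => simp
  | h j a G hG =>
    rw [mul_add, coeff_add, hG, monomial_mul_monomial, coeff_monomial, coeff_add, coeff_monomial,
      map_add, mul_add]
    by_cases hk : k ≤ i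
    · have : k + j = i ↔ j = i - k := by omega
      simp only [hk, if_true, this]
      split_ifs <;> simp
    · have : k + j ≠ i := by omega
      simp [hk, this]

theorem coeff_natDegree_ne_zero {F : SkewPoly θ} (hF : F ≠ 0) : F.coeff F.natDegree ≠ 0 := by
  have hne : F.support.Nonempty := by
    by_contra h
    apply hF
    apply ext
    intro i
    by_contra hi
    exact h ⟨i, mem_support.2 hi⟩
  obtain ⟨i, hi, he⟩ := Finset.exists_mem_eq_sup _ hne id
  rw [natDegree, he]
  exact mem_support.1 hi

theorem coeff_eq_zero_of_natDegree_lt {F : SkewPoly θ} {i : ℕ} (h : F.natDegree < i) :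
    F.coeff i = 0 := by
  by_contra hi
  exact absurd (Finset.le_sup (f := id) (mem_support.2 hi)) (not_le.2 h)

/-- Right divisibility: `D` right-divides `F` if `F = Q D` for some `Q`. -/
def RightDvd (D F : SkewPoly θ) : Prop := ∃ Q : SkewPoly θ, F = Q * D

/-- `D` is a greatest common right divisor of `F` and `G`. -/
structure IsGcrd (D F G : SkewPoly θ) : Prop where
  left : RightDvd D F
  right : RightDvd D G
  greatest : ∀ E : SkewPoly θ, RightDvd E F → RightDvd E G → RightDvd E D

/-- Left ideals are principal, so greatest common right divisors exist. -/
theorem exists_isGcrd (F G : SkewPoly θ) : ∃ D : SkewPoly θ, IsGcrd D F G := by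
  classical
  by_cases h0 : F = 0 ∧ G = 0
  · obtain ⟨rfl, rfl⟩ := h0
    exact ⟨0, ⟨0, by simp⟩, ⟨0, by simp⟩, fun _ h _ => h⟩
  let I : SkewPoly θ → Prop := fun P => ∃ U V : SkewPoly θ, P = U * F + V * G
  have hIF : I F := ⟨1, 0, by simp⟩
  have hIG : I G := ⟨0, 1, by simp⟩
  have hex : ∃ m, ∃ D : SkewPoly θ, I D ∧ D ≠ 0 ∧ D.natDegree = m := by
    by_cases hF : F = 0
    · exact ⟨_, G, hIG, fun hG => h0 ⟨hF, hG⟩, rfl⟩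
    · exact ⟨_, F, hIF, hF, rfl⟩
  obtain ⟨D, hID, hD0, hDm⟩ := Nat.find_spec hex
  have hmin : ∀ P : SkewPoly θ, I P → P ≠ 0 → D.natDegree ≤ P.natDegree := by
    intro P hP hP0
    rw [hDm]
    exact Nat.find_min' hex ⟨P, hP, hP0, rfl⟩
  have key : ∀ m, ∀ P : SkewPoly θ, I P → (∀ i, m ≤ i → P.coeff i = 0) → RightDvd D P := by
    intro m
    induction m with
    | zero => exact fun P _ h => ⟨0, by rw [zero_mul]; exact ext fun i => h i (Nat.zero_le i)⟩
    | succ m ih =>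
      intro P hP h
      by_cases hm : P.coeff m = 0
      · refine ih P hP fun i hi => ?_
        rcases Nat.eq_or_lt_of_le hi with rfl | hi
        · exact hm
        · exact h i hi
      have hP0 : P ≠ 0 := by
        rintro rfl
        exact hm (coeff_zero m)
      have hle : D.natDegree ≤ m := by
        refine (hmin P hP hP0).trans ?_
        by_contra hlt
        exact coeff_natDegree_ne_zero hP0 (h _ (by omega))
      set k := m - D.natDegree with hk
      set c := P.coeff m / (θ ^ k) (D.coeff D.natDegree) with hc
      have hlc : (θ ^ k) (D.coeff D.natDegree) ≠ 0 :=
        (map_ne_zero_iff _ (θ ^ k).injective).2 (coeff_natDegree_ne_zero hD0)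
      obtain ⟨U, V, hUV⟩ := hP
      obtain ⟨U', V', hUV'⟩ := hID
      obtain ⟨Q, hQ⟩ := ih (P - monomial θ k c * D)
        ⟨U - monomial θ k c * U', V - monomial θ k c * V', by
          rw [hUV, hUV']; noncomm_ring⟩ (by
          intro i hi
          rw [coeff_sub, coeff_monomial_mul, if_pos (by omega)]
          rcases Nat.eq_or_lt_of_le hi with rfl | hi
          · rw [show m - k = D.natDegree by omega, hc, div_mul_cancel₀ _ hlc, sub_self]
          · rw [h i hi, coeff_eq_zero_of_natDegree_lt (F := D) (by omega)]
            simp)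
      exact ⟨Q + monomial θ k c, by rw [add_mul, ← hQ, sub_add_cancel]⟩
  have all : ∀ P : SkewPoly θ, I P → RightDvd D P := fun P hP =>
    key (P.natDegree + 1) P hP fun i hi => coeff_eq_zero_of_natDegree_lt (by omega)
  refine ⟨D, all F hIF, all G hIG, ?_⟩
  rintro E ⟨A, hA⟩ ⟨B, hB⟩
  obtain ⟨U, V, hUV⟩ := hID
  exact ⟨U * A + V * B, by rw [hUV, hA, hB]; noncomm_ring⟩

/-- A greatest common right divisor; it is unique up to a nonzero constant left factor, so its
degree does not depend on the choice. -/
def gcrd (F G : SkewPoly θ) : SkewPoly θ := (exists_isGcrd F G).choose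

theorem gcrd_isGcrd (F G : SkewPoly θ) : IsGcrd (gcrd F G) F G := (exists_isGcrd F G).choose_spec

/-- The skew polynomial `X ^ n - λ`, where `n` is the order of `θ` and `λ ∈ K`. -/
def XPowSub (θ : L ≃ₐ[K] L) (l : K) : SkewPoly θ := X θ ^ orderOf θ - C θ (algebraMap K L l)

theorem XPowSub_commute (θ : L ≃ₐ[K] L) (l m : K) : Commute (XPowSub θ l) (XPowSub θ m) := by
  have hX : ∀ l : K, Commute (X θ ^ orderOf θ) (C θ (algebraMap K L l)) := fun l =>
    Commute.pow_left (by
      show _ = _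
      rw [X_mul_C, AlgEquiv.commutes]) _
  have hC : Commute (C θ (algebraMap K L l)) (C θ (algebraMap K L m)) := by
    show _ = _
    simp [C, monomial_mul_monomial, mul_comm]
  exact ((Commute.refl _).sub_right (hX m)).sub_left ((hX l).symm.sub_right hC)

/-- `H_Λ = ∏_{λ ∈ Λ} (X ^ n - λ)` for a finite set `Λ ⊆ K`; the factors commute. -/
def HPoly (θ : L ≃ₐ[K] L) (s : Finset K) : SkewPoly θ :=
  s.noncommProd (XPowSub θ) fun l _ m _ _ => XPowSub_commute θ l m

/-- The `λ`-value `d_λ(F) = deg (gcrd (F, X ^ n - λ))`. -/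
def lambdaValue (F : SkewPoly θ) (l : K) : ℕ := (gcrd F (XPowSub θ l)).natDegree

/-- The `K`-linear map `β ↦ ∑ i, f_i θ^i(β)` on `L` attached to `F = ∑ i, f_i X ^ i`. -/
def toEnd (F : SkewPoly θ) : L →ₗ[K] L := ∑ i ∈ F.support, F.coeff i • (θ ^ i).toLinearMap

/-- `ker F`, as a `K`-subspace of `L`. -/
def ker (F : SkewPoly θ) : Submodule K L := LinearMap.ker F.toEnd

/-- The truncated norm `N_i(α) = ∏_{j < i} θ^j(α)`. -/
def truncNorm (θ : L ≃ₐ[K] L) (i : ℕ) (a : L) : L := ∏ j ∈ Finset.range i, (θ ^ j) a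

/-- `F_α = F(α X) = ∑ i, f_i N_i(α) X ^ i`. -/
def scale (F : SkewPoly θ) (a : L) : SkewPoly θ :=
  ∑ i ∈ F.support, monomial θ i (F.coeff i * truncNorm θ i a)

/-- The companion matrix `C_F`: ones below the diagonal and last column `-f_i / f_d`. -/
def companion (F : SkewPoly θ) : Matrix (Fin F.natDegree) (Fin F.natDegree) L :=
  Matrix.of fun i j =>
    if (j : ℕ) + 1 = F.natDegree then -(F.coeff i / F.coeff F.natDegree)
    else if (i : ℕ) = j + 1 then 1 else 0

/-- `A_F = C_F θ(C_F) ⋯ θ^{n-1}(C_F)`, where `n` is the order of `θ`. -/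
def matA (F : SkewPoly θ) : Matrix (Fin F.natDegree) (Fin F.natDegree) L :=
  ((List.range (orderOf θ)).map fun k => F.companion.map fun a => (θ ^ k) a).prod

end SkewPoly

/-- A square matrix is diagonalizable if it is similar over `L` to a diagonal matrix. -/
def MatrixDiagonalizable {d : ℕ} (M : Matrix (Fin d) (Fin d) L) : Prop :=
  ∃ (P : Matrix (Fin d) (Fin d) L) (D : Fin d → L), IsUnit P.det ∧ M = P * Matrix.diagonal D * P⁻¹

/-- `A_F` is diagonalizable over `L`, its set of eigenvalues is `{λ ∈ Λ | d_λ(F) > 0}`, and each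
such `λ` has multiplicity `d_λ(F)` as a root of the characteristic polynomial. -/
def DiagonalizableWith {θ : L ≃ₐ[K] L} (F : SkewPoly θ) (Λ : Set K) : Prop :=
  MatrixDiagonalizable F.matA ∧
  {μ : L | Module.End.HasEigenvalue (Matrix.toLin' F.matA) μ} =
    algebraMap K L '' {l ∈ Λ | 0 < F.lambdaValue l} ∧
  ∀ l ∈ Λ, 0 < F.lambdaValue l →
    F.matA.charpoly.rootMultiplicity (algebraMap K L l) = F.lambdaValue l

end SumRank

end

/-!
The left module `V = L[X; θ] / L[X; θ] F` has `L`-dimension `d = deg F`. In the basis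
`1, X, …, X ^ (d - 1)` the indeterminate acts as `v ↦ C_F θ(v)`, so that the central element `X ^ n`
acts `L`-linearly, through the matrix `A_F` (`companionMap_pow_orderOf`). Everything is read off
from the eigenspaces of `A_F` for `λ ∈ K`.

* The cokernel of `X ^ n - λ` on `V` is `L[X; θ] / L[X; θ] D` with `D = gcrd(F, X ^ n - λ)`. Hence
  `d_λ(F)` is the dimension of the eigenspace of `A_F` for `λ` (`finrank_eigenspace_matA`).
* Let `X` act on `L` by `β ↦ α θ(β)`. Then `F` acts as `F_α` does in the usual action and
  `X ^ n - N(α)` acts as zero, so `ker F_α = ker D_α` for `λ = N(α)`. The kernel of a nonzero `G_α`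
  has `K`-dimension at most `deg G`, by splitting off linear factors (`finrank_ker_scale_le`).
  Writing `X ^ n - λ = Q D`, the kernels for `Q` and `D` have dimensions adding up to at least
  `n = deg Q + deg D`, so both bounds are sharp and `dim ker F_α = d_λ(F)`
  (`finrank_ker_scale_eq_lambdaValue`).

The sum in question is therefore the sum of the dimensions of the eigenspaces of `A_F` for the
elements of `Λ`, which is at most `d`. Equality means that these eigenspaces span, which is
diagonalizability with eigenvalues in `Λ` (`sum_finrank_eigenspace_eq_iff_diagonalizable`). It also
means that `∏ (A_F - λ) = 0` for a finite product over `Λ`; as `X ^ n` is central and the class of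
`1` generates `V`, this says that `F` right-divides `∏ (X ^ n - λ)` (`rightDvd_HPoly_iff`).
-/

/-! ### Eigenspaces and diagonalizability -/

namespace SumRank

open Module Module.End

section Eigenspaces

variable {L V : Type*} [Field L] [AddCommGroup V] [Module L V]

theorem sub_algebraMap_commute (f : End L V) (μ ν : L) :
    Commute (f - algebraMap L (End L V) μ) (f - algebraMap L (End L V) ν) :=
  ((Commute.refl f).sub_right (Algebra.commute_algebraMap_right ν f)).sub_left
    ((Algebra.commute_algebraMap_left μ f).sub_right (Algebra.commute_algebraMap_left μ _))

variable [FiniteDimensional L V]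

theorem finrank_biSup_eigenspace (f : End L V) (s : Finset L) :
    finrank L ↥(⨆ μ ∈ s, eigenspace f μ) = ∑ μ ∈ s, finrank L (eigenspace f μ) := by
  classical
  induction s using Finset.induction_on with
  | empty => simp
  | insert a s ha ih =>
    have hd : Disjoint (eigenspace f a) (⨆ μ ∈ s, eigenspace f μ) :=
      (f.eigenspaces_iSupIndep).disjoint_biSup (y := (s : Set L)) ha
    rw [Finset.iSup_insert, Finset.sum_insert ha, ← ih, ← Submodule.finrank_sup_add_finrank_inf_eq,
      hd.eq_bot, finrank_bot, add_zero]

theorem sum_finrank_eigenspace_le (f : End L V) (s : Finset L) :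
    ∑ μ ∈ s, finrank L (eigenspace f μ) ≤ finrank L V := by
  rw [← finrank_biSup_eigenspace]
  exact Submodule.finrank_le _

theorem sum_finrank_eigenspace_eq_iff (f : End L V) (s : Finset L) :
    ∑ μ ∈ s, finrank L (eigenspace f μ) = finrank L V ↔ ⨆ μ ∈ s, eigenspace f μ = ⊤ := by
  rw [← finrank_biSup_eigenspace]
  exact ⟨Submodule.eq_top_of_finrank_eq, fun h => by rw [h, finrank_top]⟩

/-- The sum of the eigenspaces for the eigenvalues in `s` is the kernel of `∏ μ ∈ s, (f - μ)`. -/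
theorem ker_noncommProd_sub_algebraMap (f : End L V) (s : Finset L) :
    LinearMap.ker (s.noncommProd (fun μ => f - algebraMap L (End L V) μ)
      fun μ _ ν _ _ => sub_algebraMap_commute f μ ν) = ⨆ μ ∈ s, eigenspace f μ := by
  have hker : ∀ μ, LinearMap.ker (f - algebraMap L (End L V) μ) = eigenspace f μ := fun μ => by
    rw [eigenspace_def, Algebra.algebraMap_eq_smul_one]
  refine (LinearMap.ker_noncommProd_eq_of_supIndep_ker s _ ?_).trans (by simp_rw [hker])
  simp_rw [hker]
  exact f.eigenspaces_iSupIndep.supIndep' s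

end Eigenspaces

variable {L : Type*} [Field L] {d : ℕ}

theorem matrixDiagonalizable_of_biSup_eigenspace_eq_top (M : Matrix (Fin d) (Fin d) L)
    (s : Finset L) (h : ⨆ μ ∈ s, eigenspace (Matrix.toLin' M) μ = ⊤) :
    MatrixDiagonalizable M := by
  set S : Set (Fin d → L) := {v | ∃ μ : L, Matrix.toLin' M v = μ • v} with hS
  have hspan : ⊤ ≤ Submodule.span L S := by
    rw [← h]
    refine iSup₂_le fun μ _ v hv => Submodule.subset_span ⟨μ, mem_eigenspace_iff.1 hv⟩
  let b₀ := Basis.ofSpan hspan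
  have := FiniteDimensional.fintypeBasisIndex b₀
  let e := Fintype.equivFinOfCardEq ((finrank_eq_card_basis b₀).symm.trans (by simp) :
    Fintype.card _ = d)
  let b := b₀.reindex e
  have hb : ∀ j, b j ∈ S := fun j => by
    rw [Basis.reindex_apply]
    exact Basis.ofSpan_subset hspan ⟨_, rfl⟩
  choose D hD using hb
  set P : Matrix (Fin d) (Fin d) L := Matrix.of fun i j => b j i with hP
  have hPdet : IsUnit P.det := by
    have : P = (Pi.basisFun L (Fin d)).toMatrix b := by
      ext i j; simp [hP, Basis.toMatrix_apply]
    rw [this, ← Basis.det_apply]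
    exact (Pi.basisFun L (Fin d)).isUnit_det b
  refine ⟨P, D, hPdet, ?_⟩
  have hMP : M * P = P * Matrix.diagonal D := by
    ext i j
    have := congrFun (hD j) i
    rw [Matrix.toLin'_apply] at this
    rw [Matrix.mul_diagonal, mul_comm]
    exact this
  rw [← hMP, Matrix.mul_assoc, Matrix.mul_nonsing_inv _ hPdet, Matrix.mul_one]

theorem MatrixDiagonalizable.charpoly_splits {M : Matrix (Fin d) (Fin d) L}
    (h : MatrixDiagonalizable M) : M.charpoly.Splits := by
  obtain ⟨P, D, hP, rfl⟩ := h
  have := Matrix.charpoly_units_conj (P.nonsingInvUnit hP) (Matrix.diagonal D)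
  change (P * Matrix.diagonal D * P⁻¹).charpoly = _ at this
  rw [this, Matrix.charpoly_diagonal]
  exact Polynomial.Splits.prod fun i _ => Polynomial.Splits.X_sub_C _

theorem finrank_eigenspace_le_rootMultiplicity (M : Matrix (Fin d) (Fin d) L) (μ : L) :
    finrank L (eigenspace (Matrix.toLin' M) μ) ≤ M.charpoly.rootMultiplicity μ := by
  rw [← Matrix.charpoly_toLin', ← LinearMap.finrank_maxGenEigenspace_eq]
  exact Submodule.finrank_mono eigenspace_le_maxGenEigenspace

theorem sum_rootMultiplicity_le_card_roots (p : Polynomial L) (s : Finset L) :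
    ∑ μ ∈ s, p.rootMultiplicity μ ≤ p.roots.card := by
  classical
  simp_rw [← Polynomial.count_roots]
  rw [← Multiset.sum_count_eq_card (s := s ∪ p.roots.toFinset) fun a ha => by simp_all]
  exact Finset.sum_le_sum_of_subset Finset.subset_union_left

/-- Full geometric multiplicity on a finite set of eigenvalues means diagonalizability with exactly
these eigenvalues, whose algebraic multiplicities then are the geometric ones. -/
theorem sum_finrank_eigenspace_eq_iff_diagonalizable (M : Matrix (Fin d) (Fin d) L) (s : Finset L)
    (hs : ∀ μ ∈ s, 0 < finrank L (eigenspace (Matrix.toLin' M) μ)) :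
    ∑ μ ∈ s, finrank L (eigenspace (Matrix.toLin' M) μ) = d ↔
      MatrixDiagonalizable M ∧ {μ : L | HasEigenvalue (Matrix.toLin' M) μ} = s ∧
      ∀ μ ∈ s, M.charpoly.rootMultiplicity μ = finrank L (eigenspace (Matrix.toLin' M) μ) := by
  classical
  have hd : finrank L (Fin d → L) = d := by simp
  have hpos : ∀ μ, HasEigenvalue (Matrix.toLin' M) μ ↔
      0 < finrank L (eigenspace (Matrix.toLin' M) μ) := fun μ => by
    rw [hasEigenvalue_iff, Nat.pos_iff_ne_zero, Ne, Ne, Submodule.finrank_eq_zero]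
  constructor
  · intro h
    refine ⟨?_, ?_, ?_⟩
    · exact matrixDiagonalizable_of_biSup_eigenspace_eq_top M s
        ((sum_finrank_eigenspace_eq_iff _ s).1 (h.trans hd.symm))
    · ext μ
      refine ⟨fun hμ => ?_, fun hμ => (hpos μ).2 (hs μ hμ)⟩
      by_contra hμs
      -- One more eigenvalue would push the sum of the dimensions above `d`.
      have h1 := sum_finrank_eigenspace_le (Matrix.toLin' M) (insert μ s)
      rw [Finset.sum_insert (by simpa using hμs), h, hd] at h1
      have := (hpos μ).1 hμ
      omega
    · have hle := fun μ (_ : μ ∈ s) => finrank_eigenspace_le_rootMultiplicity M μ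
      have h2 : ∑ μ ∈ s, M.charpoly.rootMultiplicity μ ≤ d :=
        (sum_rootMultiplicity_le_card_roots _ s).trans
          ((Polynomial.card_roots' _).trans (by simp [Matrix.charpoly_natDegree_eq_dim]))
      exact fun μ hμ => ((Finset.sum_eq_sum_iff_of_le hle).1
        (le_antisymm (Finset.sum_le_sum hle) (h2.trans h.ge)) μ hμ).symm
  · rintro ⟨hM, hev, hmul⟩
    rw [← Finset.sum_congr rfl hmul]
    simp_rw [← Polynomial.count_roots]
    rw [Multiset.sum_count_eq_card, ← hM.charpoly_splits.natDegree_eq_card_roots,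
      Matrix.charpoly_natDegree_eq_dim, Fintype.card_fin]
    intro μ hμ
    have : μ ∈ (s : Set L) := by
      rw [← hev, Set.mem_ofPred_eq, hasEigenvalue_iff_isRoot_charpoly, Matrix.charpoly_toLin']
      exact (Polynomial.mem_roots'.1 hμ).2
    exact this

end SumRank

/-! ### Skew polynomials acting on semilinear modules -/

noncomputable section

namespace SumRank

namespace SkewPoly

open Module

variable {K L : Type*} [Field K] [Field L] [Algebra K L] {θ : L ≃ₐ[K] L}

theorem coeff_eq_zero_of_natDegree_le_of_lt {F : SkewPoly θ} {m i : ℕ} (h : F.natDegree ≤ m)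
    (hi : m < i) : F.coeff i = 0 :=
  coeff_eq_zero_of_natDegree_lt (h.trans_lt hi)

theorem natDegree_le_of_coeff {F : SkewPoly θ} {m : ℕ} (h : ∀ i, m < i → F.coeff i = 0) :
    F.natDegree ≤ m :=
  Finset.sup_le fun i hi => by
    by_contra hlt
    exact mem_support.1 hi (h i (not_le.1 hlt))

theorem support_subset_range {F : SkewPoly θ} {m : ℕ} (h : ∀ i, m ≤ i → F.coeff i = 0) :
    F.support ⊆ Finset.range m := fun i hi => by
  by_contra hlt
  exact mem_support.1 hi (h i (by simpa using hlt))

theorem sum_support_eq_sum_range {M : Type*} [AddCommMonoid M] (F : SkewPoly θ) {m : ℕ}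
    (h : ∀ i, m ≤ i → F.coeff i = 0) (g : ℕ → L → M) (hg : ∀ i, g i 0 = 0) :
    ∑ i ∈ F.support, g i (F.coeff i) = ∑ i ∈ Finset.range m, g i (F.coeff i) :=
  Finset.sum_subset (support_subset_range h) fun i _ hi => by
    rw [mem_support, not_not] at hi
    rw [hi, hg]

theorem coeff_sum {ι : Type*} (s : Finset ι) (f : ι → SkewPoly θ) (i : ℕ) :
    (∑ j ∈ s, f j).coeff i = ∑ j ∈ s, (f j).coeff i := by
  classical
  induction s using Finset.induction_on with
  | empty => simp
  | insert a s ha ih => rw [Finset.sum_insert ha, Finset.sum_insert ha, coeff_add, ih]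

theorem eq_sum_monomial (F : SkewPoly θ) {m : ℕ} (h : ∀ i, m ≤ i → F.coeff i = 0) :
    F = ∑ i ∈ Finset.range m, monomial θ i (F.coeff i) := by
  apply ext
  intro i
  rw [coeff_sum]
  simp only [coeff_monomial, Finset.sum_ite_eq', Finset.mem_range]
  split_ifs with hi
  · rfl
  · exact h i (not_lt.1 hi)

theorem coeff_mul_add {Q D : SkewPoly θ} {m e : ℕ} (hQ : Q.natDegree ≤ m) (hD : D.natDegree ≤ e) :
    (Q * D).coeff (m + e) = Q.coeff m * (θ ^ m) (D.coeff e) := by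
  have hQ' : ∀ i, m + 1 ≤ i → Q.coeff i = 0 :=
    fun i hi => coeff_eq_zero_of_natDegree_le_of_lt hQ hi
  rw [eq_sum_monomial Q hQ', Finset.sum_mul, coeff_sum, ← eq_sum_monomial Q hQ',
    Finset.sum_eq_single m]
  · rw [coeff_monomial_mul, if_pos (by omega), Nat.add_sub_cancel_left]
  · intro i hi him
    have : i < m := by simp at hi; omega
    rw [coeff_monomial_mul, if_pos (by omega),
      coeff_eq_zero_of_natDegree_le_of_lt hD (by omega), map_zero, mul_zero]
  · simp

theorem natDegree_add_natDegree_le {Q D : SkewPoly θ} (hQ : Q ≠ 0) (hD : D ≠ 0) :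
    Q.natDegree + D.natDegree ≤ (Q * D).natDegree := by
  by_contra hlt
  have h := coeff_mul_add (le_refl Q.natDegree) (le_refl D.natDegree)
  rw [coeff_eq_zero_of_natDegree_lt (not_le.1 hlt)] at h
  exact mul_ne_zero (coeff_natDegree_ne_zero hQ)
    ((map_ne_zero_iff _ (θ ^ Q.natDegree).injective).2 (coeff_natDegree_ne_zero hD)) h.symm

/-- Right Euclidean division. -/
theorem exists_eq_mul_add (D : SkewPoly θ) (hD : D ≠ 0) (F : SkewPoly θ) :
    ∃ Q R : SkewPoly θ, F = Q * D + R ∧ ∀ i, D.natDegree ≤ i → R.coeff i = 0 := by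
  suffices H : ∀ m (F : SkewPoly θ), (∀ i, m ≤ i → F.coeff i = 0) →
      ∃ Q R : SkewPoly θ, F = Q * D + R ∧ ∀ i, D.natDegree ≤ i → R.coeff i = 0 from
    H (F.natDegree + 1) F fun i hi => coeff_eq_zero_of_natDegree_lt (by omega)
  intro m
  induction m with
  | zero => exact fun F h => ⟨0, F, by simp, fun i _ => h i (Nat.zero_le i)⟩
  | succ m ih =>
    intro F h
    by_cases hle : D.natDegree ≤ m
    · set k := m - D.natDegree with hk
      set c := F.coeff m / (θ ^ k) (D.coeff D.natDegree) with hc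
      have hlc : (θ ^ k) (D.coeff D.natDegree) ≠ 0 :=
        (map_ne_zero_iff _ (θ ^ k).injective).2 (coeff_natDegree_ne_zero hD)
      obtain ⟨Q, R, hQR, hR⟩ := ih (F - monomial θ k c * D) (by
        intro i hi
        rw [coeff_sub, coeff_monomial_mul, if_pos (by omega)]
        rcases Nat.eq_or_lt_of_le hi with rfl | hi
        · rw [show m - k = D.natDegree by omega, hc, div_mul_cancel₀ _ hlc, sub_self]
        · rw [h i hi, coeff_eq_zero_of_natDegree_lt (F := D) (by omega)]
          simp)
      refine ⟨Q + monomial θ k c, R, ?_, hR⟩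
      rw [sub_eq_iff_eq_add] at hQR
      rw [hQR, add_mul]
      abel
    · exact ⟨0, F, by simp, fun i hi => h i (by omega)⟩

section Action

variable {V : Type*} [AddCommGroup V] [Module L V] [Module K V]

/-- The action of `F = ∑ i, f_i X ^ i` on an `L`-space `V` on which `X` acts through `T`. When `T`
is `θ`-semilinear, this makes `V` a left module over the skew polynomial ring. -/
def act (T : End K V) (F : SkewPoly θ) (v : V) : V := ∑ i ∈ F.support, F.coeff i • (T ^ i) v

theorem act_eq_sum_range (T : End K V) (F : SkewPoly θ) (v : V) {m : ℕ}
    (h : ∀ i, m ≤ i → F.coeff i = 0) :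
    act T F v = ∑ i ∈ Finset.range m, F.coeff i • (T ^ i) v :=
  sum_support_eq_sum_range F h (fun i a => a • (T ^ i) v) fun _ => zero_smul L _

theorem act_add (T : End K V) (F G : SkewPoly θ) (v : V) :
    act T (F + G) v = act T F v + act T G v := by
  set m := max F.natDegree G.natDegree + 1
  have hF : ∀ i, m ≤ i → F.coeff i = 0 := fun i hi => coeff_eq_zero_of_natDegree_lt (by omega)
  have hG : ∀ i, m ≤ i → G.coeff i = 0 := fun i hi => coeff_eq_zero_of_natDegree_lt (by omega)
  rw [act_eq_sum_range T F v hF, act_eq_sum_range T G v hG, act_eq_sum_range T (F + G) v (m := m),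
    ← Finset.sum_add_distrib]
  · simp_rw [coeff_add, add_smul]
  · intro i hi
    rw [coeff_add, hF i hi, hG i hi, add_zero]

@[simp] theorem act_zero (T : End K V) (v : V) : act T (0 : SkewPoly θ) v = 0 := by
  rw [act_eq_sum_range T 0 v (m := 0) fun _ _ => rfl, Finset.sum_range_zero]

theorem act_sub (T : End K V) (F G : SkewPoly θ) (v : V) :
    act T (F - G) v = act T F v - act T G v := by
  rw [eq_sub_iff_add_eq, ← act_add, sub_add_cancel]

theorem act_monomial (T : End K V) (i : ℕ) (a : L) (v : V) :
    act T (monomial θ i a) v = a • (T ^ i) v := by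
  rw [act_eq_sum_range T _ v (m := i + 1), Finset.sum_eq_single i]
  · rw [coeff_monomial, if_pos rfl]
  · intro j _ hj
    rw [coeff_monomial, if_neg (Ne.symm hj), zero_smul]
  · simp
  · intro j hj
    rw [coeff_monomial, if_neg (by omega)]

theorem act_vadd (T : End K V) (F : SkewPoly θ) (v w : V) :
    act T F (v + w) = act T F v + act T F w := by
  simp [act, Finset.sum_add_distrib]

theorem act_vsmul [SMulCommClass K L V] (T : End K V) (F : SkewPoly θ) (c : K) (v : V) :
    act T F (c • v) = c • act T F v := by
  simp only [act, map_smul, Finset.smul_sum]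
  exact Finset.sum_congr rfl fun i _ => (smul_comm c _ _).symm

theorem act_vzero (T : End K V) (F : SkewPoly θ) : act T F (0 : V) = 0 := by
  simp [act]

theorem act_one (T : End K V) (v : V) : act T (1 : SkewPoly θ) v = v := by
  rw [show (1 : SkewPoly θ) = monomial θ 0 1 from X_pow (θ := θ) 0 ▸ (pow_zero _).symm,
    act_monomial, pow_zero, one_smul, End.one_apply]

theorem pow_semilinear {T : End K V} (hT : ∀ (a : L) (v : V), T (a • v) = θ a • T v) (i : ℕ)
    (a : L) (v : V) : (T ^ i) (a • v) = (θ ^ i) a • (T ^ i) v := by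
  induction i with
  | zero => simp
  | succ i ih => rw [pow_succ', End.mul_apply, ih, hT, pow_succ', End.mul_apply, AlgEquiv.mul_apply]

theorem act_mul {T : End K V} (hT : ∀ (a : L) (v : V), T (a • v) = θ a • T v) (F G : SkewPoly θ)
    (v : V) : act T (F * G) v = act T F (act T G v) := by
  induction F using induction_on with
  | h0 => simp
  | h i a F hF =>
    rw [add_mul, act_add, act_add, hF, act_monomial]
    congr 1
    clear hF
    induction G using induction_on with
    | h0 => simp
    | h j b G hG =>
      rw [mul_add, act_add, hG, monomial_mul_monomial, act_monomial, act_add, map_add, smul_add,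
        act_monomial, pow_semilinear hT, smul_smul, pow_add, End.mul_apply]

theorem act_eq_zero_of_rightDvd {T : End K V} (hT : ∀ (a : L) (v : V), T (a • v) = θ a • T v)
    {D F : SkewPoly θ} (h : RightDvd D F) {v : V} (hv : act T D v = 0) : act T F v = 0 := by
  obtain ⟨Q, rfl⟩ := h
  rw [act_mul hT, hv, act_vzero]

theorem act_XPowSub (T : End K V) (l : K) (v : V) :
    act T (XPowSub θ l) v = (T ^ orderOf θ) v - algebraMap K L l • v := by
  rw [XPowSub, act_sub, X_pow, C, act_monomial, act_monomial, one_smul, pow_zero, End.one_apply]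

end Action

/-- `X ^ n - λ` is central: `n` is the order of `θ`, and `λ` is fixed by `θ`. -/
theorem XPowSub_commute_all (l : K) (F : SkewPoly θ) : Commute (XPowSub θ l) F := by
  have h : ∀ i (a : L), Commute (XPowSub θ l) (monomial θ i a) := by
    intro i a
    have hfix : (θ ^ i) (algebraMap K L l) = algebraMap K L l := (θ ^ i).commutes l
    show _ = _
    rw [XPowSub, X_pow, C, sub_mul, mul_sub]
    simp only [monomial_mul_monomial, pow_orderOf_eq_one, hfix]
    simp [add_comm, mul_comm]
  induction F using induction_on with
  | h0 => exact Commute.zero_right _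
  | h i a F hF => exact (h i a).add_right hF

theorem coeff_XPowSub_orderOf (hn : 0 < orderOf θ) (l : K) :
    (XPowSub θ l).coeff (orderOf θ) = 1 := by
  rw [XPowSub, coeff_sub, X_pow, C, coeff_monomial, coeff_monomial, if_pos rfl, if_neg hn.ne,
    sub_zero]

theorem XPowSub_ne_zero (hn : 0 < orderOf θ) (l : K) : XPowSub θ l ≠ 0 := fun h => by
  have := coeff_XPowSub_orderOf hn l
  rw [h, coeff_zero] at this
  exact zero_ne_one this

theorem natDegree_XPowSub_le (l : K) : (XPowSub θ l).natDegree ≤ orderOf θ :=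
  natDegree_le_of_coeff fun i hi => by
    rw [XPowSub, coeff_sub, X_pow, C, coeff_monomial, coeff_monomial, if_neg hi.ne,
      if_neg (by omega), sub_zero]

theorem RightDvd.ne_zero {D F : SkewPoly θ} (h : RightDvd D F) (hF : F ≠ 0) : D ≠ 0 := by
  rintro rfl
  obtain ⟨Q, rfl⟩ := h
  exact hF (mul_zero Q)

/-- Bézout's identity for greatest common right divisors. -/
theorem IsGcrd.exists_eq_mul_add_mul {D F G : SkewPoly θ} (h : IsGcrd D F G) (hF : F ≠ 0) :
    ∃ U V : SkewPoly θ, D = U * F + V * G := by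
  classical
  let I : SkewPoly θ → Prop := fun P => ∃ U V : SkewPoly θ, P = U * F + V * G
  have hex : ∃ m, ∃ P : SkewPoly θ, I P ∧ P ≠ 0 ∧ P.natDegree = m :=
    ⟨_, F, ⟨1, 0, by simp⟩, hF, rfl⟩
  obtain ⟨E, hE, hE0, hEm⟩ := Nat.find_spec hex
  -- An element of least degree in the left ideal divides every element of the ideal.
  have hdvd : ∀ P, I P → RightDvd E P := by
    rintro P ⟨U, V, rfl⟩
    obtain ⟨Q, R, hQR, hR⟩ := exists_eq_mul_add E hE0 (U * F + V * G)
    have hR0 : R = 0 := by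
      by_contra hR0
      refine coeff_natDegree_ne_zero hR0 (hR _ ?_)
      rw [hEm]
      refine Nat.find_min' hex ⟨R, ?_, hR0, rfl⟩
      obtain ⟨U', V', hE⟩ := hE
      refine ⟨U - Q * U', V - Q * V', ?_⟩
      rw [← sub_eq_iff_eq_add'] at hQR
      rw [← hQR, hE]
      noncomm_ring
    exact ⟨Q, by rw [hQR, hR0, add_zero]⟩
  obtain ⟨W, hW⟩ := h.greatest E (hdvd F ⟨1, 0, by simp⟩) (hdvd G ⟨0, 1, by simp⟩)
  obtain ⟨U, V, hUV⟩ := hE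
  exact ⟨W * U, W * V, by rw [hW, hUV]; noncomm_ring⟩

end SkewPoly

end SumRank

end

/-! ### Kernels of skew polynomials on the simple modules -/

noncomputable section

namespace SumRank

namespace SkewPoly

open Module

variable {K L : Type*} [Field K] [Field L] [Algebra K L] {θ : L ≃ₐ[K] L}

/-- The semilinear map `β ↦ α θ(β)` on `L`. -/
def twist (θ : L ≃ₐ[K] L) (a : L) : End K L := a • θ.toLinearMap

theorem twist_apply (a b : L) : twist θ a b = a * θ b := rfl

theorem twist_semilinear (a c v : L) : twist θ a (c • v) = θ c • twist θ a v := by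
  simp only [twist_apply, smul_eq_mul, map_mul]
  ring

theorem twist_pow_apply (a : L) (i : ℕ) (b : L) :
    (twist θ a ^ i) b = truncNorm θ i a * (θ ^ i) b := by
  induction i generalizing b with
  | zero => simp [truncNorm]
  | succ i ih =>
    rw [pow_succ, End.mul_apply, ih, twist_apply, map_mul, pow_succ, AlgEquiv.mul_apply, truncNorm,
      truncNorm, Finset.prod_range_succ, mul_assoc]

theorem toLinearMap_pow_apply (i : ℕ) (v : L) : (θ.toLinearMap ^ i) v = (θ ^ i) v := by
  induction i generalizing v with
  | zero => rfl
  | succ i ih =>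
    rw [pow_succ, End.mul_apply, ih, pow_succ]
    rfl

theorem toEnd_apply (F : SkewPoly θ) (v : L) : F.toEnd v = act θ.toLinearMap F v := by
  rw [toEnd, LinearMap.sum_apply, act]
  refine Finset.sum_congr rfl fun i _ => ?_
  rw [LinearMap.smul_apply, toLinearMap_pow_apply]
  rfl

theorem act_sum {V ι : Type*} [AddCommGroup V] [Module L V] [Module K V] (T : End K V)
    (s : Finset ι) (f : ι → SkewPoly θ) (v : V) :
    act T (∑ j ∈ s, f j) v = ∑ j ∈ s, act T (f j) v := by
  classical
  induction s using Finset.induction_on with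
  | empty => simp
  | insert a s ha ih => rw [Finset.sum_insert ha, Finset.sum_insert ha, act_add, ih]

/-- `F_α` acts on `L` as `F` acts on the module `L` on which `X` acts by `β ↦ α θ(β)`. -/
theorem toEnd_scale_apply (F : SkewPoly θ) (a v : L) :
    (F.scale a).toEnd v = act (twist θ a) F v := by
  rw [toEnd_apply, scale, act_sum, act]
  refine Finset.sum_congr rfl fun i _ => ?_
  rw [act_monomial, twist_pow_apply, smul_eq_mul, smul_eq_mul, mul_assoc, toLinearMap_pow_apply]

theorem mem_ker_scale {F : SkewPoly θ} {a v : L} :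
    v ∈ (F.scale a).ker ↔ act (twist θ a) F v = 0 := by
  rw [ker, LinearMap.mem_ker, toEnd_scale_apply]

variable [FiniteDimensional K L] [IsGalois K L]

theorem mem_range_algebraMap_of_apply_eq (hθ : ∀ σ : L ≃ₐ[K] L, σ ∈ Subgroup.zpowers θ) {x : L}
    (hx : θ x = x) : x ∈ Set.range (algebraMap K L) := by
  rw [IsGalois.mem_range_algebraMap_iff_fixed]
  intro σ
  have : Subgroup.zpowers θ ≤ MulAction.stabilizer (L ≃ₐ[K] L) x := by
    rw [Subgroup.zpowers_le]
    exact hx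
  exact this (hθ σ)

theorem orderOf_eq_finrank (hθ : ∀ σ : L ≃ₐ[K] L, σ ∈ Subgroup.zpowers θ) :
    orderOf θ = finrank K L := by
  rw [orderOf_eq_card_of_forall_mem_zpowers hθ, IsGalois.card_aut_eq_finrank]

theorem truncNorm_orderOf (hθ : ∀ σ : L ≃ₐ[K] L, σ ∈ Subgroup.zpowers θ) (a : L) :
    truncNorm θ (orderOf θ) a = algebraMap K L (Algebra.norm K a) := by
  classical
  rw [Algebra.norm_eq_prod_automorphisms, ← IsCyclic.image_range_orderOf hθ, Finset.prod_image,
    truncNorm]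
  intro i hi j hj hij
  exact pow_injOn_Iio_orderOf (by simpa using hi) (by simpa using hj) hij

theorem act_twist_XPowSub_norm (hθ : ∀ σ : L ≃ₐ[K] L, σ ∈ Subgroup.zpowers θ) (a v : L) :
    act (twist θ a) (XPowSub θ (Algebra.norm K a)) v = 0 := by
  rw [act_XPowSub, twist_pow_apply, truncNorm_orderOf hθ, pow_orderOf_eq_one]
  simp

/-- Splitting off a root: if `G` kills `β ≠ 0` in the module attached to `α`, then
`G = Q (X - α θ(β) β⁻¹)`, and the kernel of the linear factor is the line spanned by `β`, because
the fixed field of `θ` is `K`. -/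
theorem finrank_ker_scale_le (hθ : ∀ σ : L ≃ₐ[K] L, σ ∈ Subgroup.zpowers θ) {a : L} (ha : a ≠ 0)
    (G : SkewPoly θ) (hG : G ≠ 0) : finrank K (G.scale a).ker ≤ G.natDegree := by
  induction hm : G.natDegree using Nat.strong_induction_on generalizing G with
  | _ m ih =>
  by_cases hbot : (G.scale a).ker = ⊥
  · rw [hbot, finrank_bot]; exact Nat.zero_le _
  obtain ⟨b, hb, hb0⟩ := Submodule.exists_mem_ne_zero_of_ne_bot hbot
  set P : SkewPoly θ := X θ - C θ (a * θ b / b) with hP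
  have hPc : ∀ i, P.coeff i = (if 1 = i then 1 else 0) - if 0 = i then a * θ b / b else 0 :=
    fun i => by rw [hP, coeff_sub, X, C, coeff_monomial, coeff_monomial]
  have hP1 : P.coeff 1 = 1 := by simp [hPc]
  have hP0 : P ≠ 0 := fun h => by simp [h] at hP1
  have hPdeg : P.natDegree = 1 :=
    le_antisymm (natDegree_le_of_coeff fun i hi => by
      rw [hPc, if_neg (by omega), if_neg (by omega), sub_zero])
      (Finset.le_sup (f := id) (mem_support.2 (by rw [hP1]; exact one_ne_zero)))
  have hPact : ∀ v, act (twist θ a) P v = a * θ v - a * θ b / b * v := fun v => by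
    rw [hP, act_sub, X, C, act_monomial, act_monomial, pow_one, pow_zero, twist_apply, one_smul,
      End.one_apply, smul_eq_mul]
  obtain ⟨Q, R, hQR, hR⟩ := exists_eq_mul_add P hP0 G
  have hRact : R.coeff 0 * b = 0 := by
    have h1 : act (twist θ a) G b = 0 := mem_ker_scale.1 hb
    rw [hQR, act_add, act_mul (twist_semilinear a), hPact, div_mul_cancel₀ _ hb0, sub_self,
      act_vzero, zero_add, act_eq_sum_range _ _ _ (by rwa [hPdeg] at hR)] at h1
    simpa using h1
  have hR0 : R = 0 := by
    apply ext
    intro i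
    rcases Nat.eq_zero_or_pos i with rfl | hi
    · exact (mul_eq_zero.1 hRact).resolve_right hb0
    · exact hR i (by omega)
  rw [hR0, add_zero] at hQR
  have hQ0 : Q ≠ 0 := by rintro rfl; exact hG (by rw [hQR, zero_mul])
  have hdeg := natDegree_add_natDegree_le hQ0 hP0
  rw [← hQR, hPdeg, hm] at hdeg
  have hQle := ih Q.natDegree (by omega) Q hQ0 rfl
  -- `P` maps `ker G` to `ker Q`; its kernel on `ker G` is at most a line.
  let p : (G.scale a).ker →ₗ[K] (Q.scale a).ker :=
    { toFun := fun v => ⟨act (twist θ a) P v, by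
        rw [mem_ker_scale, ← act_mul (twist_semilinear a), ← hQR]
        exact mem_ker_scale.1 v.2⟩
      map_add' := fun v w => Subtype.ext (act_vadd _ _ _ _)
      map_smul' := fun c v => Subtype.ext (act_vsmul _ _ _ _) }
  have hker : LinearMap.ker p ≤ K ∙ (⟨b, hb⟩ : (G.scale a).ker) := by
    intro v hv
    have hv' : a * θ v - a * θ b / b * v = 0 := by
      rw [← hPact]
      exact congrArg Subtype.val (LinearMap.mem_ker.1 hv)
    have hθb : θ b ≠ 0 := (map_ne_zero_iff _ θ.injective).2 hb0
    have hfix : θ ((v : L) / b) = (v : L) / b := by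
      rw [map_div₀, div_eq_div_iff hθb hb0]
      have hab : a * (θ v * b - v * θ b) = 0 := by
        field_simp at hv'
        linear_combination hv'
      exact sub_eq_zero.1 ((mul_eq_zero.1 hab).resolve_left ha)
    obtain ⟨c, hc⟩ := mem_range_algebraMap_of_apply_eq hθ hfix
    refine Submodule.mem_span_singleton.2 ⟨c, Subtype.ext ?_⟩
    rw [Submodule.coe_smul, Algebra.smul_def, hc, div_mul_cancel₀ _ hb0]
  have h1 := LinearMap.finrank_range_add_finrank_ker p
  have h2 := (Submodule.finrank_le (LinearMap.range p)).trans hQle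
  have h3 := (Submodule.finrank_mono hker).trans (finrank_span_le_card ({_} : Set _))
  rw [Set.toFinset_singleton, Finset.card_singleton] at h3
  omega

/-- On the simple module attached to `α`, the central polynomial `X ^ n - N(α)` vanishes, so only
the greatest common right divisor with it matters; for a right divisor of `X ^ n - N(α)` the
degree bound on kernels is an equality, because it is one for the product. -/
theorem finrank_ker_scale_eq_lambdaValue (hθ : ∀ σ : L ≃ₐ[K] L, σ ∈ Subgroup.zpowers θ) {a : L}
    (ha : a ≠ 0) (F : SkewPoly θ) (hF : F ≠ 0) :
    finrank K (F.scale a).ker = F.lambdaValue (Algebra.norm K a) := by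
  have hn : 0 < orderOf θ := orderOf_eq_finrank hθ ▸ finrank_pos
  set Z := XPowSub θ (Algebra.norm K a) with hZ
  have hgc := gcrd_isGcrd F Z
  rw [lambdaValue, ← hZ]
  set D := gcrd F Z
  have hker : (F.scale a).ker = (D.scale a).ker := by
    ext v
    rw [mem_ker_scale, mem_ker_scale]
    refine ⟨fun h => ?_, fun h => act_eq_zero_of_rightDvd (twist_semilinear a) hgc.left h⟩
    obtain ⟨U, V, hUV⟩ := hgc.exists_eq_mul_add_mul hF
    rw [hUV, act_add, act_mul (twist_semilinear a), act_mul (twist_semilinear a), h,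
      act_twist_XPowSub_norm hθ, act_vzero, act_vzero, add_zero]
  rw [hker]
  have hD0 : D ≠ 0 := hgc.left.ne_zero hF
  refine le_antisymm (finrank_ker_scale_le hθ ha D hD0) ?_
  obtain ⟨Q, hQ⟩ := hgc.right
  have hQ0 : Q ≠ 0 := by
    rintro rfl
    exact XPowSub_ne_zero hn _ (hQ.trans (zero_mul D))
  have hdeg := natDegree_add_natDegree_le hQ0 hD0
  rw [← hQ] at hdeg
  have hdeg' := hdeg.trans (natDegree_XPowSub_le _)
  have hQle := finrank_ker_scale_le hθ ha Q hQ0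
  -- As `Q D` acts as zero, `D` maps all of `L` into the kernel of `Q`.
  let p : L →ₗ[K] (Q.scale a).ker :=
    { toFun := fun v => ⟨act (twist θ a) D v, by
        rw [mem_ker_scale, ← act_mul (twist_semilinear a), ← hQ, act_twist_XPowSub_norm hθ]⟩
      map_add' := fun v w => Subtype.ext (act_vadd _ _ _ _)
      map_smul' := fun c v => Subtype.ext (act_vsmul _ _ _ _) }
  have hkerp : LinearMap.ker p = (D.scale a).ker := by
    ext v
    rw [LinearMap.mem_ker, mem_ker_scale, Subtype.ext_iff]
    rfl
  have h1 := LinearMap.finrank_range_add_finrank_ker p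
  have h2 := (Submodule.finrank_le (LinearMap.range p)).trans hQle
  rw [hkerp] at h1
  rw [orderOf_eq_finrank hθ] at hdeg'
  omega

end SkewPoly

end SumRank

end

/-! ### The companion matrix -/

noncomputable section

namespace SumRank

namespace SkewPoly

open Module

variable {K L : Type*} [Field K] [Field L] [Algebra K L] {θ : L ≃ₐ[K] L}

/-- The semilinear map `v ↦ C_F θ(v)` on `L ^ d`: multiplication by `X` on the left module
`L[X; θ] / L[X; θ] F` in the basis `1, X, …, X ^ (d - 1)`. -/
def companionMap (F : SkewPoly θ) : End K (Fin F.natDegree → L) where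
  toFun v := F.companion.mulVec fun i => θ (v i)
  map_add' v w := by
    rw [← Matrix.mulVec_add]
    congr 1
    ext i
    simp
  map_smul' c v := by
    rw [RingHom.id_apply, ← Matrix.mulVec_smul]
    congr 1
    ext i
    simp

/-- The class of `1` in `L[X; θ] / L[X; θ] F`, a generator of this module. For `d = 0` the module
is zero and the generator is the empty vector. -/
def companionGen (F : SkewPoly θ) : Fin F.natDegree → L := fun i => if (i : ℕ) = 0 then 1 else 0

theorem companionMap_apply (F : SkewPoly θ) (v : Fin F.natDegree → L) :
    F.companionMap v = F.companion.mulVec fun i => θ (v i) := rfl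

theorem companionMap_semilinear (F : SkewPoly θ) (a : L) (v : Fin F.natDegree → L) :
    F.companionMap (a • v) = θ a • F.companionMap v := by
  rw [companionMap_apply, companionMap_apply, ← Matrix.mulVec_smul]
  congr 1
  ext i
  simp

theorem companionMap_pow_apply (F : SkewPoly θ) (k : ℕ) (v : Fin F.natDegree → L) :
    (F.companionMap ^ k) v =
      ((List.range k).map fun j => F.companion.map fun a => (θ ^ j) a).prod.mulVec
        fun i => (θ ^ k) (v i) := by
  induction k generalizing v with
  | zero => simp
  | succ k ih =>
    rw [pow_succ, End.mul_apply, ih, List.range_succ, List.map_append, List.prod_append,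
      List.map_singleton, List.prod_singleton, ← Matrix.mulVec_mulVec, companionMap_apply]
    congr 1
    ext i
    simp only [Matrix.mulVec, dotProduct, map_sum, map_mul, Matrix.map_apply, pow_succ,
      AlgEquiv.mul_apply]

/-- `X ^ n` acts on `L[X; θ] / L[X; θ] F` through `A_F`. -/
theorem companionMap_pow_orderOf (F : SkewPoly θ) (v : Fin F.natDegree → L) :
    (F.companionMap ^ orderOf θ) v = Matrix.toLin' F.matA v := by
  rw [companionMap_pow_apply, Matrix.toLin'_apply, pow_orderOf_eq_one]
  rfl

theorem companionMap_single (F : SkewPoly θ) (j k : Fin F.natDegree) :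
    F.companionMap (fun i : Fin F.natDegree => if i = j then 1 else 0) k = F.companion k j := by
  rw [companionMap_apply, Matrix.mulVec, dotProduct, Finset.sum_eq_single j]
  · simp
  · intro i _ hij
    simp [hij]
  · simp

theorem companionMap_pow_gen (F : SkewPoly θ) (i : ℕ) (hi : i < F.natDegree) :
    (F.companionMap ^ i) F.companionGen =
      fun k : Fin F.natDegree => if (k : ℕ) = i then 1 else 0 := by
  induction i with
  | zero => rfl
  | succ i ih =>
    rw [pow_succ', End.mul_apply, ih (by omega)]
    ext k
    have h := F.companionMap_single ⟨i, by omega⟩ k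
    simp only [Fin.ext_iff] at h
    rw [h, companion, Matrix.of_apply, if_neg (by simp; omega)]

theorem act_companionGen_of_coeff (F G : SkewPoly θ)
    (hG : ∀ i, F.natDegree ≤ i → G.coeff i = 0) :
    act F.companionMap G F.companionGen = fun i : Fin F.natDegree => G.coeff i := by
  ext k
  rw [act_eq_sum_range _ _ _ hG, Finset.sum_apply, Finset.sum_eq_single (k : ℕ)]
  · rw [companionMap_pow_gen F k k.2]
    simp
  · intro i hi hik
    rw [companionMap_pow_gen F i (by simpa using hi)]
    simp [Ne.symm hik]
  · simp

theorem act_companionGen_self (F : SkewPoly θ) (hF : F ≠ 0) :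
    act F.companionMap F F.companionGen = 0 := by
  ext k
  obtain ⟨m, hm⟩ : ∃ m, F.natDegree = m + 1 := ⟨F.natDegree - 1, by have := k.2; omega⟩
  have hlast : (F.companionMap ^ F.natDegree) F.companionGen k =
      -(F.coeff k / F.coeff F.natDegree) := by
    have h := F.companionMap_single ⟨m, by omega⟩ k
    simp only [Fin.ext_iff] at h
    have hpow : F.companionMap ^ F.natDegree = F.companionMap * F.companionMap ^ m := by
      rw [← pow_succ']
      congr 1
    rw [hpow, End.mul_apply, companionMap_pow_gen F m (by omega), h, companion, Matrix.of_apply,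
      if_pos hm.symm]
  rw [act_eq_sum_range _ _ _ (m := F.natDegree + 1)
    fun i hi => coeff_eq_zero_of_natDegree_lt (by omega), Finset.sum_range_succ, Pi.add_apply,
    Pi.smul_apply, hlast, Finset.sum_apply, Finset.sum_eq_single (k : ℕ)]
  · rw [companionMap_pow_gen F k k.2, smul_eq_mul, mul_neg,
      mul_div_cancel₀ _ (coeff_natDegree_ne_zero hF)]
    simp
  · intro i hi hik
    rw [companionMap_pow_gen F i (by simpa using hi)]
    simp [Ne.symm hik]
  · simp

/-- The annihilator of the generator of `L[X; θ] / L[X; θ] F` is the left ideal of `F`. -/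
theorem rightDvd_iff_act_companionGen (F : SkewPoly θ) (hF : F ≠ 0) (G : SkewPoly θ) :
    RightDvd F G ↔ act F.companionMap G F.companionGen = 0 := by
  refine ⟨fun h => act_eq_zero_of_rightDvd F.companionMap_semilinear h
    (act_companionGen_self F hF), fun h => ?_⟩
  obtain ⟨Q, R, hQR, hR⟩ := exists_eq_mul_add F hF G
  rw [hQR, act_add, act_mul F.companionMap_semilinear, act_companionGen_self F hF, act_vzero,
    zero_add, act_companionGen_of_coeff F R hR] at h
  have hR0 : R = 0 := by
    apply ext
    intro i
    by_cases hi : F.natDegree ≤ i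
    · exact hR i hi
    · exact congrFun h ⟨i, by omega⟩
  exact ⟨Q, by rw [hQR, hR0, add_zero]⟩

theorem exists_act_companionGen_eq (F : SkewPoly θ) (v : Fin F.natDegree → L) :
    ∃ G : SkewPoly θ, act F.companionMap G F.companionGen = v := by
  refine ⟨∑ j : Fin F.natDegree, monomial θ j (v j), ?_⟩
  rw [act_sum]
  ext k
  simp only [act_monomial, Finset.sum_apply]
  rw [Finset.sum_eq_single k]
  · rw [companionMap_pow_gen F k k.2]
    simp
  · intro i _ hik
    rw [companionMap_pow_gen F i i.2]
    simp [Fin.ext_iff.not.1 (Ne.symm hik)]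
  · simp

theorem act_companionMap_XPowSub (F : SkewPoly θ) (l : K) (v : Fin F.natDegree → L) :
    act F.companionMap (XPowSub θ l) v =
      (Matrix.toLin' F.matA - algebraMap L (End L (Fin F.natDegree → L)) (algebraMap K L l)) v := by
  rw [act_XPowSub, companionMap_pow_orderOf]
  rfl

/-- For a right divisor `D` of `F`, the projection
`L[X; θ] / L[X; θ] F → L[X; θ] / L[X; θ] D`. -/
def companionProj (F D : SkewPoly θ) : (Fin F.natDegree → L) →ₗ[L] (Fin D.natDegree → L) :=
  Fintype.linearCombination L fun i : Fin F.natDegree => (D.companionMap ^ (i : ℕ)) D.companionGen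

theorem companionProj_act {F D : SkewPoly θ} (hF : F ≠ 0) (hD : RightDvd D F) (G : SkewPoly θ) :
    companionProj F D (act F.companionMap G F.companionGen) =
      act D.companionMap G D.companionGen := by
  obtain ⟨Q, R, hQR, hR⟩ := exists_eq_mul_add F hF G
  have hDF := (rightDvd_iff_act_companionGen D (hD.ne_zero hF) F).1 hD
  rw [hQR, act_add, act_add, act_mul F.companionMap_semilinear, act_companionGen_self F hF,
    act_mul D.companionMap_semilinear, hDF, act_vzero, act_vzero, zero_add, zero_add,
    act_companionGen_of_coeff F R hR, act_eq_sum_range _ R _ hR, companionProj,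
    Fintype.linearCombination_apply, Finset.sum_range]

/-- `d_λ(F)` is the dimension of the cokernel of `X ^ n - λ` on `L[X; θ] / L[X; θ] F`, hence of its
kernel, which is the eigenspace of `A_F` for `λ`. -/
theorem finrank_eigenspace_matA (F : SkewPoly θ) (hF : F ≠ 0) (l : K) :
    finrank L (End.eigenspace (Matrix.toLin' F.matA) (algebraMap K L l)) = F.lambdaValue l := by
  set f := Matrix.toLin' F.matA - algebraMap L (End L (Fin F.natDegree → L)) (algebraMap K L l)
    with hf
  have heig : End.eigenspace (Matrix.toLin' F.matA) (algebraMap K L l) = LinearMap.ker f := by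
    rw [End.eigenspace_def, hf, Algebra.algebraMap_eq_smul_one (A := End L _)]
  set Z := XPowSub θ l with hZ
  have hgc := gcrd_isGcrd F Z
  rw [lambdaValue, ← hZ, heig]
  set D := gcrd F Z
  have hD0 : D ≠ 0 := hgc.left.ne_zero hF
  have hfact : ∀ G : SkewPoly θ, f (act F.companionMap G F.companionGen) =
      act F.companionMap (G * Z) F.companionGen := fun G => by
    rw [hf, ← act_companionMap_XPowSub, ← act_mul F.companionMap_semilinear,
      (XPowSub_commute_all l G).eq]
  have hsurj : LinearMap.range (companionProj F D) = ⊤ := by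
    rw [LinearMap.range_eq_top]
    intro w
    obtain ⟨G, hG⟩ := exists_act_companionGen_eq D w
    exact ⟨_, (companionProj_act hF hgc.left G).trans hG⟩
  -- By Bézout, the left ideal of `D` is the one generated by `F` and `X ^ n - λ`.
  have hker : LinearMap.ker (companionProj F D) = LinearMap.range f := by
    ext v
    obtain ⟨G, rfl⟩ := exists_act_companionGen_eq F v
    rw [LinearMap.mem_ker, companionProj_act hF hgc.left, ← rightDvd_iff_act_companionGen D hD0]
    constructor
    · rintro ⟨W, rfl⟩
      obtain ⟨U, V, hUV⟩ := hgc.exists_eq_mul_add_mul hF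
      refine ⟨act F.companionMap (W * V) F.companionGen, ?_⟩
      have hdecomp : W * D = W * U * F + W * V * Z := by
        rw [hUV, mul_add, mul_assoc, mul_assoc]
      rw [hfact, hdecomp, act_add, act_mul F.companionMap_semilinear (W * U),
        act_companionGen_self F hF, act_vzero, zero_add]
    · rintro ⟨w, hw⟩
      obtain ⟨G', rfl⟩ := exists_act_companionGen_eq F w
      rw [rightDvd_iff_act_companionGen D hD0, ← companionProj_act hF hgc.left, ← hw, hfact,
        companionProj_act hF hgc.left, ← rightDvd_iff_act_companionGen D hD0]
      obtain ⟨B, hB⟩ := hgc.right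
      exact ⟨G' * B, by rw [hB, mul_assoc]⟩
  have h1 := LinearMap.finrank_range_add_finrank_ker (companionProj F D)
  have h2 := LinearMap.finrank_range_add_finrank_ker f
  rw [hsurj, finrank_top, hker] at h1
  simp only [finrank_fin_fun] at h1 h2
  omega

theorem act_companionMap_HPoly (F : SkewPoly θ) (s : Finset K) (v : Fin F.natDegree → L) :
    act F.companionMap (HPoly θ s) v =
      (s.map ⟨algebraMap K L, (algebraMap K L).injective⟩).noncommProd
        (fun μ => Matrix.toLin' F.matA - algebraMap L (End L (Fin F.natDegree → L)) μ)
        (fun μ _ ν _ _ => sub_algebraMap_commute _ μ ν) v := by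
  classical
  induction s using Finset.induction_on generalizing v with
  | empty =>
    have h : HPoly θ (∅ : Finset K) = 1 := Finset.noncommProd_empty _ _
    rw [h, act_one]
    rfl
  | insert a s ha ih =>
    have h : HPoly θ (insert a s) = XPowSub θ a * HPoly θ s :=
      Finset.noncommProd_insert_of_notMem s a _ _ ha
    rw [h, act_mul F.companionMap_semilinear, ih, act_companionMap_XPowSub]
    simp only [Finset.map_insert]
    rw [Finset.noncommProd_insert_of_notMem _ _ _ _ (by simpa using ha), End.mul_apply]
    rfl

theorem sum_lambdaValue_eq (F : SkewPoly θ) (hF : F ≠ 0) (s : Finset K) :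
    ∑ l ∈ s, F.lambdaValue l =
      ∑ μ ∈ s.map ⟨algebraMap K L, (algebraMap K L).injective⟩,
        finrank L (End.eigenspace (Matrix.toLin' F.matA) μ) := by
  rw [Finset.sum_map]
  exact Finset.sum_congr rfl fun l _ => (finrank_eigenspace_matA F hF l).symm

theorem sum_lambdaValue_le (F : SkewPoly θ) (hF : F ≠ 0) (s : Finset K) :
    ∑ l ∈ s, F.lambdaValue l ≤ F.natDegree := by
  rw [sum_lambdaValue_eq F hF]
  exact (sum_finrank_eigenspace_le _ _).trans_eq (by simp)

theorem finite_lambdaValue_pos (F : SkewPoly θ) (hF : F ≠ 0) :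
    {l : K | 0 < F.lambdaValue l}.Finite := by
  refine Set.Finite.of_finite_image ((End.finite_hasEigenvalue (Matrix.toLin' F.matA)).subset ?_)
    (algebraMap K L).injective.injOn
  rintro _ ⟨l, hl, rfl⟩
  rw [Set.mem_ofPred_eq, ← finrank_eigenspace_matA F hF] at hl
  exact fun hbot => hl.ne' (Submodule.finrank_eq_zero.2 hbot)

/-- `t` is the finite set of the `λ ∈ S` for which `d_λ(F)` is positive. -/
theorem diagonalizableWith_iff (F : SkewPoly θ) (hF : F ≠ 0) (S : Set K) (t : Finset K)
    (ht : ∀ l, l ∈ t ↔ l ∈ S ∧ 0 < F.lambdaValue l) :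
    DiagonalizableWith F S ↔ ∑ l ∈ t, F.lambdaValue l = F.natDegree := by
  have h := sum_finrank_eigenspace_eq_iff_diagonalizable F.matA
    (t.map ⟨algebraMap K L, (algebraMap K L).injective⟩) (by
      simp only [Finset.mem_map, Function.Embedding.coeFn_mk, forall_exists_index, and_imp,
        forall_apply_eq_imp_iff₂]
      intro l hl
      rw [finrank_eigenspace_matA F hF]
      exact ((ht l).1 hl).2)
  have ht' : ((t.map ⟨algebraMap K L, (algebraMap K L).injective⟩ : Finset L) : Set L) =
      algebraMap K L '' {l ∈ S | 0 < F.lambdaValue l} := by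
    ext μ
    simp [ht]
  rw [sum_lambdaValue_eq F hF, h, ht', DiagonalizableWith]
  refine and_congr_right fun _ => and_congr_right fun _ =>
    ⟨fun hm μ hμ => ?_, fun hm l hl hpos => ?_⟩
  · obtain ⟨l, hl, rfl⟩ := Finset.mem_map.1 hμ
    exact (hm l ((ht l).1 hl).1 ((ht l).1 hl).2).trans (finrank_eigenspace_matA F hF l).symm
  · exact (hm _ (Finset.mem_map_of_mem _ ((ht l).2 ⟨hl, hpos⟩))).trans
      (finrank_eigenspace_matA F hF l)

/-- `F` right-divides `∏ λ ∈ s, (X ^ n - λ)` exactly when `∏ λ ∈ s, (A_F - λ) = 0`, that is, when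
the eigenspaces of `A_F` for the elements of `s` span. -/
theorem rightDvd_HPoly_iff (F : SkewPoly θ) (hF : F ≠ 0) (s : Finset K) :
    RightDvd F (HPoly θ s) ↔ ∑ l ∈ s, F.lambdaValue l = F.natDegree := by
  have hcomm : ∀ G : SkewPoly θ, Commute G (HPoly θ s) := fun G =>
    Finset.noncommProd_commute _ _ _ _ fun l _ => (XPowSub_commute_all l G).symm
  have hd : finrank L (Fin F.natDegree → L) = F.natDegree := by simp
  have htop := sum_finrank_eigenspace_eq_iff (Matrix.toLin' F.matA)
    (s.map ⟨algebraMap K L, (algebraMap K L).injective⟩)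
  rw [hd] at htop
  rw [sum_lambdaValue_eq F hF, htop,
    ← ker_noncommProd_sub_algebraMap, rightDvd_iff_act_companionGen F hF, LinearMap.ker_eq_top]
  constructor
  · intro h
    refine LinearMap.ext fun v => ?_
    obtain ⟨G, rfl⟩ := exists_act_companionGen_eq F v
    rw [← act_companionMap_HPoly, ← act_mul F.companionMap_semilinear, ← (hcomm G).eq,
      act_mul F.companionMap_semilinear, h, act_vzero]
    rfl
  · intro h
    rw [act_companionMap_HPoly, h]
    rfl

end SkewPoly

end SumRank

end

/-! ### The bound and its equality case -/

open SumRank SkewPoly in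
theorem mainTheorem5 {K L : Type*} [Field K] [Field L] [Algebra K L] [FiniteDimensional K L]
    [IsGalois K L] (θ : L ≃ₐ[K] L) (hθ : ∀ σ : L ≃ₐ[K] L, σ ∈ Subgroup.zpowers θ)
    (F : SkewPoly θ) (hF : F ≠ 0) (A : Set L) (hA0 : (0 : L) ∉ A)
    (hA : Set.InjOn (Algebra.norm K) A) :
    {α ∈ A | (F.scale α).ker ≠ ⊥}.Finite ∧
    (∑ᶠ α ∈ A, Module.finrank K (F.scale α).ker) ≤ F.natDegree ∧
    (∀ Λ : Finset K, (Λ : Set K) = Algebra.norm K '' A →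
      List.TFAE [
        (∑ᶠ α ∈ A, Module.finrank K (F.scale α).ker) = F.natDegree,
        DiagonalizableWith F (Algebra.norm K '' A),
        F.RightDvd (HPoly θ Λ)]) ∧
    List.TFAE [
      (∑ᶠ α ∈ A, Module.finrank K (F.scale α).ker) = F.natDegree,
      DiagonalizableWith F (Algebra.norm K '' A),
      ∃ Λ : Finset K, (Λ : Set K) ⊆ Algebra.norm K '' A ∧ F.RightDvd (HPoly θ Λ)] := by
  classical
  have hdim : ∀ α ∈ A, Module.finrank K (F.scale α).ker = F.lambdaValue (Algebra.norm K α) :=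
    fun α hα => finrank_ker_scale_eq_lambdaValue hθ (fun h => hA0 (h ▸ hα)) F hF
  have hfin : {l ∈ Algebra.norm K '' A | 0 < F.lambdaValue l}.Finite :=
    (finite_lambdaValue_pos F hF).subset fun l hl => hl.2
  set t := hfin.toFinset with ht
  have hmem : ∀ l, l ∈ t ↔ l ∈ Algebra.norm K '' A ∧ 0 < F.lambdaValue l := fun l => by
    rw [ht, Set.Finite.mem_toFinset]
    rfl
  -- The norm is injective on `A`, and the finite set `t` carries all nonzero terms, so the `finsum`
  -- is a genuine sum.
  have hsum : (∑ᶠ α ∈ A, Module.finrank K (F.scale α).ker) = ∑ l ∈ t, F.lambdaValue l := by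
    rw [finsum_mem_congr rfl hdim, ← finsum_mem_image (f := fun l => F.lambdaValue l) hA]
    refine finsum_mem_eq_sum_of_inter_support_eq _ ?_
    ext l
    simp [hmem, Nat.pos_iff_ne_zero]
  have hsub : ∀ s : Finset K, (s : Set K) ⊆ Algebra.norm K '' A →
      ∑ l ∈ s, F.lambdaValue l ≤ ∑ l ∈ t, F.lambdaValue l := fun s hs =>
    Finset.sum_le_sum_of_ne_zero fun l hl h0 => (hmem l).2 ⟨hs hl, Nat.pos_of_ne_zero h0⟩
  have hts : (t : Set K) ⊆ Algebra.norm K '' A := fun l hl => ((hmem l).1 hl).1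
  have hle := sum_lambdaValue_le F hF t
  have h12 := diagonalizableWith_iff F hF _ t hmem
  refine ⟨?_, hsum.trans_le hle, fun Λ hΛ => ?_, ?_⟩
  · refine Set.Finite.of_finite_image (hfin.subset ?_) (hA.mono fun α hα => hα.1)
    rintro _ ⟨α, ⟨hα, hne⟩, rfl⟩
    refine ⟨⟨α, hα, rfl⟩, ?_⟩
    rw [← hdim α hα, Nat.pos_iff_ne_zero, Ne, Submodule.finrank_eq_zero]
    exact hne
  · rw [hsum]
    tfae_have 1 ↔ 2 := h12.symm
    tfae_have 1 → 3 := fun h => (rightDvd_HPoly_iff F hF Λ).2 <|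
      le_antisymm (sum_lambdaValue_le F hF Λ) <| h.ge.trans <| Finset.sum_le_sum_of_subset
        fun l hl => Finset.mem_coe.1 (hΛ ▸ hts hl)
    tfae_have 3 → 1 := fun h =>
      le_antisymm hle (((rightDvd_HPoly_iff F hF Λ).1 h).ge.trans (hsub Λ hΛ.subset))
    tfae_finish
  · rw [hsum]
    tfae_have 1 ↔ 2 := h12.symm
    tfae_have 1 → 3 := fun h => ⟨t, hts, (rightDvd_HPoly_iff F hF t).2 h⟩
    tfae_have 3 → 1 := fun ⟨Λ, hΛ, h⟩ =>
      le_antisymm hle (((rightDvd_HPoly_iff F hF Λ).1 h).ge.trans (hsub Λ hΛ))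
    tfae_finish
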